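/- Let $\lambda$ denote Lebesgue measure on $\mathbb R^2$. For $(x,u)\in\mathbb R^2$ let $\mathbb P^+_{x,u}$ be the law on $C([0,\infty),\mathbb R^2)$ of the Kolmogorov process $Z=(Y,W)$ started from $(x,u)$, that is, $W_t=u+B_t$ and $Y_t=x+\int_0^t W_s\,ds$ for $t\ge 0$, where $B$ is a standard real Brownian motion. Let $\mathbb P_{x,u}$ be the law on $C(\mathbb R,\mathbb R^2)$ of the process $(Z_t)_{t\in\mathbb R}=(Y_t,W_t)_{t\in\mathbb R}$ such that $(Y_t,W_t)_{t\ge 0}$ has law $\mathbb P^+_{x,u}$ and $(Y_{-t},-W_{-t})_{t\ge 0}$ is independent of it and has law $\mathbb P^+_{x,-u}$. Let $\mathbb P_\lambda=\int_{\mathbb R^2}dx\,du\,\mathbb P_{x,u}$, an infinite measure on $C(\mathbb R,\mathbb R^2)$ under which the canonical process $Z=(Y,W)$ is called the stationary Kolmogorov process, and write $\overline Z=(Y,-W)$ for the conjugate of $Z$. Path spaces carry the $\sigma$-algebra generated by the coordinates. Then: 1. Under $\mathbb P_\lambda$, the processes $(Z_t)_{t\in\mathbb R}$ and $(\overline Z_{-t})_{t\in\mathbb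 R}$ have the same law. 2. Under $\mathbb P_\lambda$, for every $t_0\in\mathbb R$, the processes $(Z_t)_{t\in\mathbb R}$ and $(Z_{t_0+t})_{t\in\mathbb R}$ have the same law. 3. Under $\mathbb P_\lambda$, $Z$ is a stationary Markov process indexed by $\mathbb R$, with stationary measure $\lambda$ and the (time-homogeneous) evolution of the Kolmogorov process. That is: $(x,u)\mapsto\mathbb P^+_{x,u}$ is a measurable family of probability measures, $Z_0=(x,u)$ holds $\mathbb P^+_{x,u}$-almost surely, $\mathbb P_\lambda$ is invariant under time-translation, $Z_t$ has law $\lambda$ under $\mathbb P_\lambda$ for every $t\in\mathbb R$, and for every $t\in\mathbb R$, every event $A\in\mathcal F_t=\sigma(Z_s:s\le t)$ and every measurable $F:C([0,\infty),\mathbb R^2)\to[0,\infty]$, $$\mathbb E_\lambda\big[\mathbf 1_A\,F\big((Z_{t+s})_{s\ge 0}\big)\big]=\mathbb E_\lambda\big[\mathbf 1_A\,\mathbb E^+_{Z_t}[F]\big].$$ -/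

import Mathlib

open MeasureTheory ProbabilityTheory
open scoped NNReal ENNReal

namespace Kolmogorov

/-- The cylinder sigma-algebra on a space of continuous paths, generated by the coordinate maps
`z ↦ z t`. -/
instance pathMeasurableSpace {T E : Type*} [TopologicalSpace T] [TopologicalSpace E]
    [MeasurableSpace E] : MeasurableSpace C(T, E) :=
  ⨆ t : T, MeasurableSpace.comap (fun z : C(T, E) => z t) inferInstance

open Classical in
/-- A function, regarded as an element of the space of continuous paths. The value at a
discontinuous function is irrelevant: below, this is applied to almost surely continuous paths. -/
noncomputable def toPath {T : Type*} [TopologicalSpace T] (z : T → ℝ × ℝ) : C(T, ℝ × ℝ) :=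
  if h : Continuous z then ⟨z, h⟩ else ContinuousMap.const T 0

/-- Conjugation of a state: the position is kept and the velocity changes sign. -/
def conj (p : ℝ × ℝ) : ℝ × ℝ := (p.1, -p.2)

lemma continuous_conj : Continuous conj :=
  continuous_fst.prodMk continuous_snd.neg

/-- The path `t ↦ (Y t, W t)` with initial state `(x, u) = p` driven by `w`:
`W t = u + w t` and `Y t = x + ∫ s in 0..t, W s`. -/
noncomputable def drivenPath (p : ℝ × ℝ) (w : ℝ≥0 → ℝ) (t : ℝ≥0) : ℝ × ℝ :=
  (p.1 + ∫ s in (0 : ℝ)..(t : ℝ), (p.2 + w s.toNNReal), p.2 + w t)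

/-- The law on `C([0, ∞), ℝ × ℝ)` of the Kolmogorov process started from the state `p`, where `B`
is a standard Brownian motion under `P`. -/
noncomputable def lawPlus {Ω : Type*} [MeasurableSpace Ω] (P : Measure Ω) (B : ℝ≥0 → Ω → ℝ)
    (p : ℝ × ℝ) : Measure C(ℝ≥0, ℝ × ℝ) :=
  P.map (fun ω => toPath (drivenPath p (fun t => B t ω)))

/-- The path indexed by `ℝ` that follows `z` at nonnegative times and whose conjugated
time-reversal follows `z'`. -/
noncomputable def glue (z z' : ℝ≥0 → ℝ × ℝ) (t : ℝ) : ℝ × ℝ :=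
  if 0 ≤ t then z t.toNNReal else conj (z' (-t).toNNReal)

/-- The law on `C(ℝ, ℝ × ℝ)` of the Kolmogorov process indexed by `ℝ` with state `p` at time `0`:
`(Z t)`, `t ≥ 0`, has the law of the process started from `p`, and `(conj (Z (-t)))`, `t ≥ 0`, is
independent of it and has the law of the process started from `conj p`. -/
noncomputable def lawTwoSided {Ω : Type*} [MeasurableSpace Ω] (P : Measure Ω) (B : ℝ≥0 → Ω → ℝ)
    (p : ℝ × ℝ) : Measure C(ℝ, ℝ × ℝ) :=
  ((lawPlus P B p).prod (lawPlus P B (conj p))).map (fun y => toPath (glue y.1 y.2))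

/-- The law of the stationary Kolmogorov process: the integral of the laws of the processes with
state `p` at time `0`, with respect to the Lebesgue measure `dp` on `ℝ × ℝ`. -/
noncomputable def stationaryLaw {Ω : Type*} [MeasurableSpace Ω] (P : Measure Ω)
    (B : ℝ≥0 → Ω → ℝ) : Measure C(ℝ, ℝ × ℝ) :=
  (volume : Measure (ℝ × ℝ)).bind (lawTwoSided P B)

/-- Time-reversal combined with conjugation, `z ↦ (t ↦ conj (z (-t)))`. -/
def reverseConj (z : C(ℝ, ℝ × ℝ)) : C(ℝ, ℝ × ℝ) :=
  ⟨fun t => conj (z (-t)), continuous_conj.comp (z.continuous.comp continuous_neg)⟩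

section Markov

variable {E : Type*} [TopologicalSpace E]

/-- Time-translation, `z ↦ (t ↦ z (t₀ + t))`. -/
def shift (t₀ : ℝ) (z : C(ℝ, E)) : C(ℝ, E) :=
  ⟨fun t => z (t₀ + t), z.continuous.comp (continuous_const.add continuous_id)⟩

/-- The path after time `t`, `z ↦ (s ↦ z (t + s))` for `s ≥ 0`. -/
def future (t : ℝ) (z : C(ℝ, E)) : C(ℝ≥0, E) :=
  ⟨fun s => z (t + s), z.continuous.comp (continuous_const.add NNReal.continuous_coe)⟩

variable [MeasurableSpace E]

/-- The natural filtration: the sigma-algebra generated by the `z s` for `s ≤ t`. -/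
@[reducible] def past (t : ℝ) : MeasurableSpace C(ℝ, E) :=
  ⨆ s : Set.Iic t, MeasurableSpace.comap (fun z : C(ℝ, E) => z s) inferInstance

/-- Under the (possibly infinite) measure `μ` on paths, the canonical process indexed by `ℝ` is a
stationary Markov process, where `κ e` is the law of the (time-homogeneous) Markov evolution started
from `e`, and `m` is the stationary measure. -/
structure IsStationaryMarkov (μ : Measure C(ℝ, E)) (κ : E → Measure C(ℝ≥0, E))
    (m : Measure E) : Prop where
  /-- The family `κ` is measurable. -/
  measurable_kernel : Measurable κ
  /-- Each `κ e` is a probability measure. -/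
  isProbabilityMeasure_kernel : ∀ e, IsProbabilityMeasure (κ e)
  /-- Under `κ e`, the process starts from `e`. -/
  start_kernel : ∀ e, ∀ᵐ y ∂κ e, y 0 = e
  /-- Stationarity: the law is invariant under all time-translations. -/
  stationary : ∀ t₀ : ℝ, μ.map (shift t₀) = μ
  /-- At each time the state is distributed according to `m`. -/
  marginal : ∀ t : ℝ, μ.map (fun z => z t) = m
  /-- Markov property at every time `t`: conditionally on the past up to time `t`, the future after
  `t` has law `κ (z t)`. -/
  markov : ∀ (t : ℝ) (A : Set C(ℝ, E)), MeasurableSet[past t] A →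
    ∀ F : C(ℝ≥0, E) → ℝ≥0∞, Measurable F →
      ∫⁻ z in A, F (future t z) ∂μ = ∫⁻ z in A, (∫⁻ y, F y ∂κ (z t)) ∂μ

end Markov

end Kolmogorov

/-!
The Kolmogorov process is a deterministic functional of its initial state and of a driving Brownian
motion, so every law in the statement is an image of a product measure, and each claim becomes a
statement about a measure-preserving map of that product. Transporting the given Brownian motion to
the path space (`pathLaw`, `isWiener_pathLaw`) and joining two independent copies `w`, `w'` of it
into the two-sided Brownian motion `V t = w t` for `t ≥ 0`, `V t = -w' (-t)` for `t ≤ 0`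
(`bilateral`), the stationary law is the image of `dp ⊗ law V` under
`(p, v) ↦ driveReal p v`, where `driveReal (x, u) v t = (x + ∫ s in 0..t, (u + v s), u + v t)`
(`stationaryLaw_eq_map`).

* Reversal with conjugation maps the path driven by `(w, w')` from `p` to the path driven by
  `(w', w)` from `conj p`. The exchange preserves the product law and `conj` preserves the Lebesgue
  measure (`map_reverseConj_stationaryLaw`).
* Translation by `a` maps the path driven by `v` from `p` to the path driven by the increments
  `v (a + ·) - v a` from `driveReal p v a` (`shift_driveReal`). For fixed `v`, the map
  `p ↦ driveReal p v a` is a shear followed by a translation, so it preserves the Lebesgue measure;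
  and the increments of `V` have the law of `V`, since both are centered Gaussian processes with
  covariance `(|s| + |t| - |s - t|) / 2` (`IsWiener.measurePreserving_increment`). A skew product of
  these two maps preserves `dp ⊗ law V` (`map_shift_stationaryLaw`).
* At time `0`, the past is a function of `(p, w')` and the future is the path driven by `w` from
  `p`, so the Markov property is Fubini's theorem (`markov_zero`). Stationarity moves it to every
  other time.
-/

namespace Kolmogorov

/-! ### Measurability on path spaces -/

section PathSpace

variable {T E α : Type*} [TopologicalSpace T] [TopologicalSpace E] [MeasurableSpace E]

lemma measurable_path_eval (t : T) : Measurable (fun z : C(T, E) => z t) :=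
  measurable_iff_comap_le.2 (le_iSup (fun t : T =>
    MeasurableSpace.comap (fun z : C(T, E) => z t) inferInstance) t)

lemma measurable_path_of_eval [MeasurableSpace α] {f : α → C(T, E)}
    (hf : ∀ t, Measurable fun a => f a t) : Measurable f := by
  refine measurable_iff_comap_le.2 ?_
  rw [pathMeasurableSpace, MeasurableSpace.comap_iSup]
  refine iSup_le fun t => ?_
  rw [MeasurableSpace.comap_comp]
  exact (hf t).comap_le

lemma measurable_path_coe : Measurable (fun (z : C(T, E)) (t : T) => z t) :=
  measurable_pi_lambda _ measurable_path_eval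

lemma pathMeasurableSpace_eq_comap_pi :
    (pathMeasurableSpace : MeasurableSpace C(T, E)) =
      MeasurableSpace.comap (fun (z : C(T, E)) (t : T) => z t) MeasurableSpace.pi := by
  refine le_antisymm ?_ measurable_path_coe.comap_le
  refine iSup_le fun t => ?_
  have : (fun z : C(T, E) => z t) = (fun x : T → E => x t) ∘ fun (z : C(T, E)) (t : T) => z t := rfl
  rw [this, ← MeasurableSpace.comap_comp]
  exact MeasurableSpace.comap_mono (measurable_pi_apply t).comap_le

/-- A law on a path space is determined by its image on the product space. -/
lemma path_measure_ext {μ ν : Measure C(T, E)}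
    (h : μ.map (fun (z : C(T, E)) (t : T) => z t) = ν.map (fun (z : C(T, E)) (t : T) => z t)) :
    μ = ν := by
  ext s hs
  rw [pathMeasurableSpace_eq_comap_pi] at hs
  obtain ⟨s', hs', rfl⟩ := hs
  rw [← Measure.map_apply measurable_path_coe hs', h, Measure.map_apply measurable_path_coe hs']

lemma measurable_path_uncurry [TopologicalSpace.MetrizableSpace T] [SecondCountableTopology T]
    [MeasurableSpace T] [OpensMeasurableSpace T] [TopologicalSpace.PseudoMetrizableSpace E]
    [BorelSpace E] : Measurable (fun q : C(T, E) × T => q.1 q.2) :=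
  (measurable_uncurry_of_continuous_of_measurable (u := fun (t : T) (z : C(T, E)) => z t)
    (fun z => z.continuous) measurable_path_eval).comp measurable_swap

end PathSpace

/-- A process with almost surely continuous paths, each of whose coordinates is almost everywhere
measurable, is almost everywhere measurable as a random element of the path space. -/
lemma aemeasurable_path {T E Ω : Type*} [TopologicalSpace T] [FirstCountableTopology T]
    [TopologicalSpace.SeparableSpace T] [Nonempty T] [TopologicalSpace E]
    [TopologicalSpace.PseudoMetrizableSpace E] [MeasurableSpace E] [BorelSpace E] [Zero E]
    [MeasurableSpace Ω] {P : Measure Ω} {X : T → Ω → E} (hX : ∀ t, AEMeasurable (X t) P)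
    {b : Ω → C(T, E)} (hb : ∀ᵐ ω ∂P, ∀ t, b ω t = X t ω) : AEMeasurable b P := by
  classical
  let d := TopologicalSpace.denseSeq T
  let X' : T → Ω → E := fun t => (hX t).mk
  have hgood : ∀ᵐ ω ∂P, ∀ n, b ω (d n) = X' (d n) ω := by
    have h2 : ∀ᵐ ω ∂P, ∀ n, X (d n) ω = X' (d n) ω := ae_all_iff.2 fun n => (hX (d n)).ae_eq_mk
    filter_upwards [hb, h2] with ω h h' n
    rw [h, h']
  obtain ⟨N, hN, hNm, hNs⟩ := hgood.exists_measurable_mem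
  refine ⟨fun ω => if ω ∈ N then b ω else ContinuousMap.const T 0, ?_, ?_⟩
  · refine measurable_path_of_eval fun t => ?_
    -- the value at `t` is a limit of values at points of the dense sequence
    obtain ⟨s, hs, hst⟩ := mem_closure_iff_seq_limit.1 (TopologicalSpace.denseRange_denseSeq T t)
    choose n hn using hs
    refine measurable_of_tendsto_metrizable
      (f := fun k ω => if ω ∈ N then X' (d (n k)) ω else 0) (fun k => ?_) ?_
    · exact Measurable.ite hNm (hX _).measurable_mk measurable_const
    · refine tendsto_pi_nhds.2 fun ω => ?_
      by_cases hω : ω ∈ N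
      · simp only [hω, if_true, ← hNs ω hω]
        have : s = fun k => d (n k) := funext fun k => (hn k).symm
        rw [this] at hst
        exact ((b ω).continuous.tendsto t).comp hst
      · simpa [hω] using tendsto_const_nhds
  · filter_upwards [hN] with ω hω
    simp [hω]

/-! ### The driven paths -/

open Classical in
/-- A function regarded as a continuous path, with a junk value at discontinuous functions. -/
noncomputable def contPath (x : ℝ≥0 → ℝ) : C(ℝ≥0, ℝ) :=
  if h : Continuous x then ⟨x, h⟩ else 0

lemma contPath_apply {x : ℝ≥0 → ℝ} (h : Continuous x) (t : ℝ≥0) : contPath x t = x t := by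
  simp [contPath, h]

lemma toPath_apply {T : Type*} [TopologicalSpace T] {z : T → ℝ × ℝ} (h : Continuous z) (t : T) :
    toPath z t = z t := by
  simp [toPath, h]

lemma continuous_drivenPath (p : ℝ × ℝ) {w : ℝ≥0 → ℝ} (hw : Continuous w) :
    Continuous (drivenPath p w) := by
  have h : Continuous fun s : ℝ => p.2 + w s.toNNReal := by fun_prop
  have h' : Continuous fun t : ℝ => ∫ s in (0 : ℝ)..t, (p.2 + w s.toNNReal) :=
    intervalIntegral.continuous_primitive (fun a b => h.intervalIntegrable a b) 0
  unfold drivenPath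
  fun_prop

/-- The continuous path `drivenPath p w`, for a continuous `w`. -/
noncomputable def drive (p : ℝ × ℝ) (w : C(ℝ≥0, ℝ)) : C(ℝ≥0, ℝ × ℝ) :=
  ⟨drivenPath p w, continuous_drivenPath p w.continuous⟩

/-- The path `t ↦ (Y t, W t)`, `t` real, with state `(x, u) = p` at time `0` driven by `v`:
`W t = u + v t` and `Y t = x + ∫ s in 0..t, W s`. -/
noncomputable def driveReal (p : ℝ × ℝ) (v : C(ℝ, ℝ)) : C(ℝ, ℝ × ℝ) where
  toFun t := (p.1 + ∫ s in (0 : ℝ)..t, (p.2 + v s), p.2 + v t)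
  continuous_toFun := by
    have h : Continuous fun s : ℝ => p.2 + v s := by fun_prop
    have h' : Continuous fun t : ℝ => ∫ s in (0 : ℝ)..t, (p.2 + v s) :=
      intervalIntegral.continuous_primitive (fun a b => h.intervalIntegrable a b) 0
    fun_prop

/-- The real-indexed path that follows `w.1` forwards and `-w.2` backwards from time `0`; when
`w.1` and `w.2` are independent Brownian motions, it is a two-sided Brownian motion. -/
def bilateral (w : C(ℝ≥0, ℝ) × C(ℝ≥0, ℝ)) : C(ℝ, ℝ) :=
  ⟨fun t => w.1 t.toNNReal - w.2 (-t).toNNReal, by fun_prop⟩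

lemma measurable_intervalIntegral_path {T α : Type*} [TopologicalSpace T] [MeasurableSpace α]
    [TopologicalSpace.MetrizableSpace T] [SecondCountableTopology T]
    [MeasurableSpace T] [OpensMeasurableSpace T] {c : α → ℝ} (hc : Measurable c)
    {w : α → C(T, ℝ)} (hw : Measurable w) {τ : ℝ → T} (hτ : Measurable τ) (a b : ℝ) :
    Measurable fun x => ∫ s in a..b, (c x + w x (τ s)) := by
  have h : StronglyMeasurable (fun q : α × ℝ => c q.1 + w q.1 (τ q.2)) :=
    ((hc.comp measurable_fst).add (measurable_path_uncurry.comp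
      ((hw.comp measurable_fst).prodMk (hτ.comp measurable_snd)))).stronglyMeasurable
  unfold intervalIntegral
  exact (h.integral_prod_right (ν := volume.restrict (Set.Ioc a b))).measurable.sub
    (h.integral_prod_right (ν := volume.restrict (Set.Ioc b a))).measurable

lemma measurable_drive : Measurable fun q : (ℝ × ℝ) × C(ℝ≥0, ℝ) => drive q.1 q.2 := by
  refine measurable_path_of_eval fun t => ?_
  refine Measurable.prodMk ?_ ?_
  · exact (measurable_fst.comp measurable_fst).add (measurable_intervalIntegral_path
      (measurable_snd.comp measurable_fst) measurable_snd
      continuous_real_toNNReal.measurable 0 t)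
  · exact (measurable_snd.comp measurable_fst).add
      ((measurable_path_eval t).comp measurable_snd)

lemma measurable_drive_right (p : ℝ × ℝ) : Measurable (drive p) :=
  measurable_drive.comp measurable_prodMk_left

lemma measurable_driveReal : Measurable fun q : (ℝ × ℝ) × C(ℝ, ℝ) => driveReal q.1 q.2 := by
  refine measurable_path_of_eval fun t => ?_
  refine Measurable.prodMk ?_ ?_
  · exact (measurable_fst.comp measurable_fst).add (measurable_intervalIntegral_path
      (τ := id) (measurable_snd.comp measurable_fst) measurable_snd measurable_id 0 t)
  · exact (measurable_snd.comp measurable_fst).add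
      ((measurable_path_eval t).comp measurable_snd)

lemma measurable_bilateral : Measurable bilateral :=
  measurable_path_of_eval fun t => ((measurable_path_eval t.toNNReal).comp measurable_fst).sub
    ((measurable_path_eval (-t).toNNReal).comp measurable_snd)

lemma driveReal_bilateral_of_nonneg (p : ℝ × ℝ) {w : C(ℝ≥0, ℝ) × C(ℝ≥0, ℝ)} (h : w.2 0 = 0)
    {t : ℝ} (ht : 0 ≤ t) : driveReal p (bilateral w) t = drive p w.1 t.toNNReal := by
  have hv : ∀ s : ℝ, 0 ≤ s → bilateral w s = w.1 s.toNNReal := fun s hs => by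
    simp [bilateral, Real.toNNReal_of_nonpos (neg_nonpos.2 hs), h]
  refine Prod.ext ?_ ?_
  · change p.1 + _ = p.1 + _
    rw [Real.coe_toNNReal t ht]
    congr 1
    refine intervalIntegral.integral_congr fun s hs => ?_
    rw [Set.uIcc_of_le ht] at hs
    simp only [hv s hs.1]
  · change p.2 + _ = p.2 + _
    rw [hv t ht]

/-- Conjugated time-reversal of a driven path exchanges the two halves of the driving path. -/
lemma reverseConj_driveReal_bilateral (p : ℝ × ℝ) (w : C(ℝ≥0, ℝ) × C(ℝ≥0, ℝ)) :
    reverseConj (driveReal p (bilateral w)) = driveReal (conj p) (bilateral w.swap) := by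
  ext t
  · change p.1 + _ = p.1 + _
    congr 1
    have h : ∀ s : ℝ, -p.2 + bilateral w.swap s = -(p.2 + bilateral w (-s)) := fun s => by
      simp [bilateral]; ring
    change _ = ∫ s in (0 : ℝ)..t, (-p.2 + bilateral w.swap s)
    simp_rw [h]
    rw [intervalIntegral.integral_neg,
      intervalIntegral.integral_comp_neg (fun s => p.2 + bilateral w s),
      intervalIntegral.integral_symm, neg_zero]
  · simp [reverseConj, driveReal, conj, bilateral]
    ring

lemma reverseConj_apply (z : C(ℝ, ℝ × ℝ)) (t : ℝ) : reverseConj z t = conj (z (-t)) := rfl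

lemma glue_drive (p : ℝ × ℝ) {w : C(ℝ≥0, ℝ) × C(ℝ≥0, ℝ)} (h₁ : w.1 0 = 0) (h₂ : w.2 0 = 0)
    (t : ℝ) : glue (drive p w.1) (drive (conj p) w.2) t = driveReal p (bilateral w) t := by
  unfold glue
  split_ifs with ht
  · exact (driveReal_bilateral_of_nonneg p h₂ ht).symm
  · have h := driveReal_bilateral_of_nonneg (conj p) (w := w.swap) h₁
      (neg_nonneg.2 (le_of_not_ge ht))
    rw [← reverseConj_driveReal_bilateral, reverseConj_apply, neg_neg] at h
    rw [Prod.fst_swap] at h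
    rw [← h]
    simp [conj]

/-- Gluing is measurable, even though it is only meaningful on the measurable set of pairs whose
gluing is continuous. -/
lemma measurable_toPath_glue :
    Measurable fun y : C(ℝ≥0, ℝ × ℝ) × C(ℝ≥0, ℝ × ℝ) => toPath (glue y.1 y.2) := by
  classical
  have hcont : ∀ y : C(ℝ≥0, ℝ × ℝ) × C(ℝ≥0, ℝ × ℝ),
      Continuous (glue y.1 y.2) ↔ y.1 0 = conj (y.2 0) := by
    intro y
    have h₁ : Continuous fun t : ℝ => y.1 t.toNNReal := by fun_prop
    have h₂ : Continuous fun t : ℝ => conj (y.2 (-t).toNNReal) :=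
      continuous_conj.comp (by fun_prop)
    refine ⟨fun h => ?_, fun h => ?_⟩
    · have heq : Set.EqOn (glue y.1 y.2) (fun t : ℝ => conj (y.2 (-t).toNNReal)) (Set.Iio 0) :=
        fun t ht => by simp [glue, not_le.2 (Set.mem_Iio.1 ht)]
      have h0 := heq.closure h h₂ (x := 0) (by simp [closure_Iio])
      simpa [glue] using h0
    · refine Continuous.if_le h₁ h₂ continuous_const continuous_id ?_
      rintro t rfl
      simpa using h
  have hm : MeasurableSet {y : C(ℝ≥0, ℝ × ℝ) × C(ℝ≥0, ℝ × ℝ) | y.1 0 = conj (y.2 0)} :=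
    measurableSet_eq_fun ((measurable_path_eval 0).comp measurable_fst)
      (continuous_conj.measurable.comp ((measurable_path_eval 0).comp measurable_snd))
  refine measurable_path_of_eval fun t => ?_
  have : (fun y : C(ℝ≥0, ℝ × ℝ) × C(ℝ≥0, ℝ × ℝ) => toPath (glue y.1 y.2) t) =
      fun y => if y.1 0 = conj (y.2 0) then glue y.1 y.2 t else 0 := by
    funext y
    split_ifs with h
    · exact toPath_apply ((hcont y).2 h) t
    · simp [toPath, (hcont y).not.2 h]
  rw [this]
  refine Measurable.ite hm ?_ measurable_const
  unfold glue
  split_ifs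
  · exact (measurable_path_eval _).comp measurable_fst
  · exact continuous_conj.measurable.comp ((measurable_path_eval _).comp measurable_snd)

/-! ### Gaussian processes and the two-sided Brownian motion -/

/-- The finite-dimensional laws of a real Gaussian process are determined by its mean and its
covariance. -/
lemma _root_.ProbabilityTheory.IsGaussianProcess.map_restrict_eq {T Ω Ω' : Type*}
    [MeasurableSpace Ω] [MeasurableSpace Ω'] {P : Measure Ω} {P' : Measure Ω'}
    {X : T → Ω → ℝ} {Y : T → Ω' → ℝ} (hX : IsGaussianProcess X P) (hY : IsGaussianProcess Y P')
    (hmean : ∀ t, P[X t] = P'[Y t]) (hcov : ∀ s t, cov[X s, X t; P] = cov[Y s, Y t; P'])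
    (I : Finset T) :
    P.map (fun ω => I.restrict (X · ω)) = P'.map (fun ω => I.restrict (Y · ω)) := by
  classical
  have := hX.isProbabilityMeasure
  have := hY.isProbabilityMeasure
  have : IsProbabilityMeasure (P.map (fun ω => I.restrict (X · ω))) :=
    Measure.isProbabilityMeasure_map (hX.hasGaussianLaw I).aemeasurable
  have : IsProbabilityMeasure (P'.map (fun ω => I.restrict (Y · ω))) :=
    Measure.isProbabilityMeasure_map (hY.hasGaussianLaw I).aemeasurable
  refine Measure.ext_of_charFunDual (funext fun L => ?_)
  rw [(hX.hasGaussianLaw I).charFunDual_map_eq_fun, (hY.hasGaussianLaw I).charFunDual_map_eq_fun]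
  have hL : ∀ x : I → ℝ, L x = ∑ i, L (Pi.single i 1) * x i := fun x => by
    conv_lhs => rw [← Finset.univ_sum_single x, map_sum]
    refine Finset.sum_congr rfl fun i _ => ?_
    have : Pi.single i (x i) = x i • (Pi.single i 1 : I → ℝ) := by
      rw [← Pi.single_smul, smul_eq_mul, mul_one]
    rw [this, map_smul, smul_eq_mul, mul_comm]
  have hLX : (fun ω => L (I.restrict (X · ω))) = fun ω => ∑ i : I, L (Pi.single i 1) * X i ω :=
    funext fun ω => hL _
  have hLY : (fun ω => L (I.restrict (Y · ω))) = fun ω => ∑ i : I, L (Pi.single i 1) * Y i ω :=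
    funext fun ω => hL _
  have hX2 : ∀ i : I, MemLp (fun ω => L (Pi.single i 1) * X i ω) 2 P := fun i =>
    (hX.hasGaussianLaw_eval i).memLp_two.const_mul _
  have hY2 : ∀ i : I, MemLp (fun ω => L (Pi.single i 1) * Y i ω) 2 P' := fun i =>
    (hY.hasGaussianLaw_eval i).memLp_two.const_mul _
  have h1 : ∫ ω, L (I.restrict (X · ω)) ∂P = ∫ ω, L (I.restrict (Y · ω)) ∂P' := by
    rw [hLX, hLY, integral_finsetSum _ fun i _ => (hX2 i).integrable one_le_two,
      integral_finsetSum _ fun i _ => (hY2 i).integrable one_le_two]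
    simp_rw [integral_const_mul, hmean]
  have h2 : Var[fun ω => L (I.restrict (X · ω)); P] =
      Var[fun ω => L (I.restrict (Y · ω)); P'] := by
    rw [hLX, hLY, ← covariance_self, ← covariance_self, covariance_fun_sum_fun_sum hX2 hX2,
      covariance_fun_sum_fun_sum hY2 hY2]
    · simp_rw [covariance_const_mul_left, covariance_const_mul_right]
      refine Finset.sum_congr rfl fun i _ => Finset.sum_congr rfl fun j _ => ?_
      rw [← hcov]
    · exact Finset.aemeasurable_fun_sum _ fun i _ => (hY2 i).aemeasurable
    · exact Finset.aemeasurable_fun_sum _ fun i _ => (hX2 i).aemeasurable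
  rw [h1, h2]

/-- `ν` is the law on the path space of a Brownian motion: the coordinate process is Brownian. -/
abbrev IsWiener (ν : Measure C(ℝ≥0, ℝ)) : Prop :=
  IsPreBrownianReal (fun (t : ℝ≥0) (w : C(ℝ≥0, ℝ)) => w t) ν

section Wiener

variable {ν : Measure C(ℝ≥0, ℝ)}

lemma IsWiener.isProbabilityMeasure (hν : IsWiener ν) : IsProbabilityMeasure ν :=
  hν.isGaussianProcess.isProbabilityMeasure

lemma IsWiener.isPreBrownianReal_fst (hν : IsWiener ν) :
    IsPreBrownianReal (fun (t : ℝ≥0) (w : C(ℝ≥0, ℝ) × C(ℝ≥0, ℝ)) => w.1 t) (ν.prod ν) where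
  hasLaw I := by
    have := hν.isProbabilityMeasure
    exact (hν.hasLaw I).comp (measurePreserving_fst (μ := ν) (ν := ν)).hasLaw

lemma IsWiener.isPreBrownianReal_snd (hν : IsWiener ν) :
    IsPreBrownianReal (fun (t : ℝ≥0) (w : C(ℝ≥0, ℝ) × C(ℝ≥0, ℝ)) => w.2 t) (ν.prod ν) where
  hasLaw I := by
    have := hν.isProbabilityMeasure
    exact (hν.hasLaw I).comp (measurePreserving_snd (μ := ν) (ν := ν)).hasLaw

lemma IsWiener.isGaussianProcess_bilateral (hν : IsWiener ν) :
    IsGaussianProcess (fun (t : ℝ) w => bilateral w t) (ν.prod ν) where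
  hasGaussianLaw I := by
    have := hν.isProbabilityMeasure
    have h₁ := (hν.isPreBrownianReal_fst.isGaussianProcess.comp_right
      Real.toNNReal).hasGaussianLaw I
    have h₂ := (hν.isPreBrownianReal_snd.isGaussianProcess.comp_right
      (fun t : ℝ => (-t).toNNReal)).hasGaussianLaw I
    refine iIndepFun.hasGaussianLaw_fun_sub h₁ h₂ ?_
    exact indepFun_prod (X := fun w : C(ℝ≥0, ℝ) => I.restrict fun t : ℝ => w t.toNNReal)
      (Y := fun w : C(ℝ≥0, ℝ) => I.restrict fun t : ℝ => w (-t).toNNReal)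
      (measurable_pi_lambda _ fun _ => measurable_path_eval _)
      (measurable_pi_lambda _ fun _ => measurable_path_eval _)

lemma IsWiener.integral_bilateral (hν : IsWiener ν) (t : ℝ) :
    ∫ w, bilateral w t ∂(ν.prod ν) = 0 := by
  have h := integral_sub (hν.isPreBrownianReal_fst.integrable_eval t.toNNReal)
    (hν.isPreBrownianReal_snd.integrable_eval (-t).toNNReal)
  rw [hν.isPreBrownianReal_fst.integral_eval, hν.isPreBrownianReal_snd.integral_eval,
    sub_zero] at h
  exact h

lemma IsWiener.covariance_bilateral (hν : IsWiener ν) (s t : ℝ) :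
    cov[fun w => bilateral w s, fun w => bilateral w t; ν.prod ν] =
      (|s| + |t| - |s - t|) / 2 := by
  have := hν.isProbabilityMeasure
  have h₁ (r : ℝ≥0) : MemLp (fun w : C(ℝ≥0, ℝ) × C(ℝ≥0, ℝ) => w.1 r) 2 (ν.prod ν) :=
    (hν.isPreBrownianReal_fst.isGaussianProcess.hasGaussianLaw_eval r).memLp_two
  have h₂ (r : ℝ≥0) : MemLp (fun w : C(ℝ≥0, ℝ) × C(ℝ≥0, ℝ) => w.2 r) 2 (ν.prod ν) :=
    (hν.isPreBrownianReal_snd.isGaussianProcess.hasGaussianLaw_eval r).memLp_two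
  have h₁₂ (r r' : ℝ≥0) : cov[fun w : C(ℝ≥0, ℝ) × C(ℝ≥0, ℝ) => w.1 r,
      fun w => w.2 r'; ν.prod ν] = 0 :=
    (indepFun_prod (μ := ν) (ν := ν) (measurable_path_eval r)
      (measurable_path_eval r')).covariance_eq_zero (h₁ r) (h₂ r')
  have h := covariance_fun_sub_fun_sub (h₁ s.toNNReal) (h₂ (-s).toNNReal) (h₁ t.toNNReal)
    (h₂ (-t).toNNReal)
  rw [h₁₂, covariance_comm (fun w : C(ℝ≥0, ℝ) × C(ℝ≥0, ℝ) => w.2 (-s).toNNReal), h₁₂,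
    hν.isPreBrownianReal_fst.covariance_eval, hν.isPreBrownianReal_snd.covariance_eval] at h
  refine h.trans ?_
  push_cast
  simp only [Real.coe_toNNReal']
  grind

/-- The path `t ↦ v (a + t) - v a` of the increments after the time `a`. -/
def increment (a : ℝ) (v : C(ℝ, ℝ)) : C(ℝ, ℝ) :=
  ⟨fun t => v (a + t) - v a, by fun_prop⟩

lemma measurable_increment (a : ℝ) : Measurable (increment a) :=
  measurable_path_of_eval fun t => (measurable_path_eval (a + t)).sub (measurable_path_eval a)

/-- The increments of a two-sided Brownian motion after any time, of either sign, are a two-sided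
Brownian motion: both processes are centered Gaussian with covariance `(|s| + |t| - |s - t|) / 2`. -/
lemma IsWiener.measurePreserving_increment (hν : IsWiener ν) (a : ℝ) :
    MeasurePreserving (increment a) ((ν.prod ν).map bilateral) ((ν.prod ν).map bilateral) := by
  have := hν.isProbabilityMeasure
  refine ⟨measurable_increment a, path_measure_ext ?_⟩
  rw [Measure.map_map (measurable_increment a) measurable_bilateral,
    Measure.map_map measurable_path_coe ((measurable_increment a).comp measurable_bilateral),
    Measure.map_map measurable_path_coe measurable_bilateral]
  have hG := hν.isGaussianProcess_bilateral
  refine (map_eq_iff_forall_finset_map_restrict_eq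
    (X := fun (t : ℝ) w => increment a (bilateral w) t) (Y := fun (t : ℝ) w => bilateral w t)
    (measurable_path_coe.comp
      ((measurable_increment a).comp measurable_bilateral)).aemeasurable
    (measurable_path_coe.comp measurable_bilateral).aemeasurable).2 ?_
  refine (hG.shift a).map_restrict_eq hG (fun t => ?_) (fun s t => ?_)
  · rw [integral_sub (hG.hasGaussianLaw_eval _).integrable (hG.hasGaussianLaw_eval _).integrable,
      hν.integral_bilateral, hν.integral_bilateral, hν.integral_bilateral, sub_zero]
  · have h2 (r : ℝ) := (hG.hasGaussianLaw_eval r).memLp_two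
    rw [covariance_fun_sub_fun_sub (h2 _) (h2 _) (h2 _) (h2 _)]
    simp only [hν.covariance_bilateral]
    rw [show a + s - (a + t) = s - t by ring, show a + s - a = s by ring,
      show a - (a + t) = -t by ring, sub_self, abs_neg, abs_zero]
    ring

end Wiener

/-! ### The laws of the Kolmogorov processes as images of Brownian laws -/

section Law

lemma measurable_map_of_uncurry {α β γ : Type*} [MeasurableSpace α] [MeasurableSpace β]
    [MeasurableSpace γ] {ν : Measure β} [SFinite ν] {f : α → β → γ}
    (hf : Measurable fun q : α × β => f q.1 q.2) : Measurable fun a => ν.map (f a) := by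
  have h : (fun a => ν.map (f a)) =
      fun a => (ν.map (Prod.mk a)).map fun q : α × β => f q.1 q.2 := by
    funext a
    rw [Measure.map_map hf measurable_prodMk_left]
    rfl
  rw [h]
  exact (Measure.measurable_map _ hf).comp Measurable.map_prodMk_left

lemma bind_map_eq_map_prod {α β γ : Type*} [MeasurableSpace α] [MeasurableSpace β]
    [MeasurableSpace γ] {μ : Measure α} {ν : Measure β} [SFinite ν] {f : α → β → γ}
    (hf : Measurable fun q : α × β => f q.1 q.2) :
    μ.bind (fun a => ν.map (f a)) = (μ.prod ν).map fun q => f q.1 q.2 := by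
  ext s hs
  rw [Measure.bind_apply hs (measurable_map_of_uncurry hf).aemeasurable, Measure.map_apply hf hs,
    Measure.prod_apply (hf hs)]
  refine lintegral_congr fun a => ?_
  have hfa : Measurable (f a) := hf.comp measurable_prodMk_left
  rw [Measure.map_apply hfa hs]
  rfl

variable {Ω : Type*} [MeasurableSpace Ω] {P : Measure Ω} {B : ℝ≥0 → Ω → ℝ}

/-- The law on `C([0, ∞), ℝ)` of a process `B` with almost surely continuous paths. -/
noncomputable def pathLaw (P : Measure Ω) (B : ℝ≥0 → Ω → ℝ) : Measure C(ℝ≥0, ℝ) :=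
  P.map fun ω => contPath fun t => B t ω

lemma aemeasurable_contPath (hB : IsBrownianReal B P) :
    AEMeasurable (fun ω => contPath fun t => B t ω) P :=
  aemeasurable_path hB.aemeasurable (hB.cont.mono fun _ hω t => contPath_apply hω t)

lemma isWiener_pathLaw (hB : IsBrownianReal B P) : IsWiener (pathLaw P B) where
  hasLaw I := by
    have hm : Measurable fun w : C(ℝ≥0, ℝ) => I.restrict fun t => w t :=
      measurable_pi_lambda _ fun _ => measurable_path_eval _
    refine ⟨hm.aemeasurable, ?_⟩
    rw [pathLaw, AEMeasurable.map_map_of_aemeasurable hm.aemeasurable (aemeasurable_contPath hB),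
      ← (hB.hasLaw I).map_eq]
    refine Measure.map_congr ?_
    filter_upwards [hB.cont] with ω hω
    exact funext fun t => contPath_apply hω t

lemma lawPlus_eq_map (hB : IsBrownianReal B P) (p : ℝ × ℝ) :
    lawPlus P B p = (pathLaw P B).map (drive p) := by
  rw [pathLaw, AEMeasurable.map_map_of_aemeasurable (measurable_drive_right p).aemeasurable
    (aemeasurable_contPath hB)]
  refine Measure.map_congr ?_
  filter_upwards [hB.cont] with ω hω
  have h : (contPath fun t => B t ω : ℝ≥0 → ℝ) = fun t => B t ω := funext (contPath_apply hω)
  refine ContinuousMap.ext fun t => ?_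
  rw [toPath_apply (continuous_drivenPath p hω)]
  change _ = drivenPath p (contPath fun t => B t ω) t
  rw [h]

lemma IsWiener.ae_eval_zero {ν : Measure C(ℝ≥0, ℝ)} (hν : IsWiener ν) :
    ∀ᵐ w ∂(ν.prod ν), w.1 0 = 0 ∧ w.2 0 = 0 :=
  hν.isPreBrownianReal_fst.eval_zero_ae_eq_zero.and hν.isPreBrownianReal_snd.eval_zero_ae_eq_zero

lemma lawTwoSided_eq_map (hB : IsBrownianReal B P) (p : ℝ × ℝ) :
    lawTwoSided P B p =
      ((pathLaw P B).prod (pathLaw P B)).map fun w => driveReal p (bilateral w) := by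
  have hν := isWiener_pathLaw hB
  have := hν.isProbabilityMeasure
  have hm := measurable_drive_right
  rw [lawTwoSided, lawPlus_eq_map hB, lawPlus_eq_map hB,
    Measure.map_prod_map _ _ (hm _) (hm _),
    Measure.map_map measurable_toPath_glue ((hm _).prodMap (hm _))]
  refine Measure.map_congr ?_
  filter_upwards [hν.ae_eval_zero] with w hw
  have h : glue (drive p w.1) (drive (conj p) w.2) = driveReal p (bilateral w) :=
    funext (glue_drive p hw.1 hw.2)
  refine ContinuousMap.ext fun t => ?_
  change toPath (glue (drive p w.1) (drive (conj p) w.2)) t = _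
  rw [h, toPath_apply (driveReal p (bilateral w)).continuous]

lemma measurable_driveReal_bilateral :
    Measurable fun q : (ℝ × ℝ) × C(ℝ≥0, ℝ) × C(ℝ≥0, ℝ) => driveReal q.1 (bilateral q.2) :=
  measurable_driveReal.comp (measurable_fst.prodMk (measurable_bilateral.comp measurable_snd))

/-- The stationary law is an image of the product of the Lebesgue measure and of the laws of the two
driving Brownian motions. -/
lemma stationaryLaw_eq_map (hB : IsBrownianReal B P) :
    stationaryLaw P B =
      ((volume : Measure (ℝ × ℝ)).prod ((pathLaw P B).prod (pathLaw P B))).map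
        fun q => driveReal q.1 (bilateral q.2) := by
  have := (isWiener_pathLaw hB).isProbabilityMeasure
  rw [stationaryLaw, funext (lawTwoSided_eq_map hB)]
  exact bind_map_eq_map_prod measurable_driveReal_bilateral

end Law

/-! ### Symmetries of the stationary law -/

lemma measurable_reverseConj : Measurable reverseConj :=
  measurable_path_of_eval fun t => continuous_conj.measurable.comp (measurable_path_eval (-t))

lemma measurable_shift {E : Type*} [TopologicalSpace E] [MeasurableSpace E] (a : ℝ) :
    Measurable (shift a : C(ℝ, E) → C(ℝ, E)) :=
  measurable_path_of_eval fun t => measurable_path_eval (a + t)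

lemma measurable_future {E : Type*} [TopologicalSpace E] [MeasurableSpace E] (a : ℝ) :
    Measurable (future a : C(ℝ, E) → C(ℝ≥0, E)) :=
  measurable_path_of_eval fun t => measurable_path_eval (a + t)

lemma measurePreserving_conj : MeasurePreserving conj :=
  (MeasurePreserving.id volume).prod (Measure.measurePreserving_neg volume)

/-- For a fixed driving path, the state at time `t` is obtained from the initial state by a shear
and a translation, which preserve the Lebesgue measure. -/
lemma measurePreserving_driveReal_eval (v : C(ℝ, ℝ)) (t : ℝ) :
    MeasurePreserving fun p : ℝ × ℝ => driveReal p v t := by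
  have heq : (fun p : ℝ × ℝ => driveReal p v t) =
      Prod.swap ∘ (fun q : ℝ × ℝ => (q.1 + v t, q.2 + (t * q.1 + ∫ s in (0 : ℝ)..t, v s))) ∘
        Prod.swap := by
    funext p
    refine Prod.ext ?_ rfl
    change p.1 + ∫ s in (0 : ℝ)..t, (p.2 + v s) = p.1 + (t * p.2 + ∫ s in (0 : ℝ)..t, v s)
    rw [intervalIntegral.integral_add (by simp) (v.continuous.intervalIntegrable _ _)]
    simp
  rw [heq]
  have hswap : MeasurePreserving (Prod.swap : ℝ × ℝ → ℝ × ℝ) :=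
    Measure.measurePreserving_swap (μ := (volume : Measure ℝ)) (ν := (volume : Measure ℝ))
  refine hswap.comp (MeasurePreserving.comp ?_ hswap)
  exact (measurePreserving_add_right volume (v t)).skew_product
    (g := fun u x => x + (t * u + ∫ s in (0 : ℝ)..t, v s)) (by fun_prop)
    (Filter.Eventually.of_forall fun u => (measurePreserving_add_right volume _).map_eq)

lemma shift_driveReal (p : ℝ × ℝ) (v : C(ℝ, ℝ)) (a : ℝ) :
    shift a (driveReal p v) = driveReal (driveReal p v a) (increment a v) := by
  have hi (b c : ℝ) : IntervalIntegrable (fun s => p.2 + v s) volume b c :=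
    Continuous.intervalIntegrable (by fun_prop) b c
  ext t
  · change p.1 + ∫ s in (0 : ℝ)..(a + t), (p.2 + v s) =
      (p.1 + ∫ s in (0 : ℝ)..a, (p.2 + v s)) +
        ∫ s in (0 : ℝ)..t, (p.2 + v a + (v (a + s) - v a))
    have h : ∀ s, p.2 + v a + (v (a + s) - v a) = p.2 + v (a + s) := fun s => by ring
    simp_rw [h]
    rw [intervalIntegral.integral_comp_add_left (fun s => p.2 + v s), add_zero, add_assoc,
      intervalIntegral.integral_add_adjacent_intervals (hi _ _) (hi _ _)]
  · change p.2 + v (a + t) = p.2 + v a + (v (a + t) - v a)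
    ring

section Stationary

variable {Ω : Type*} [MeasurableSpace Ω] {P : Measure Ω} {B : ℝ≥0 → Ω → ℝ}

lemma map_reverseConj_stationaryLaw (hB : IsBrownianReal B P) :
    (stationaryLaw P B).map reverseConj = stationaryLaw P B := by
  have := (isWiener_pathLaw hB).isProbabilityMeasure
  have hmp := measurePreserving_conj.prod
    (Measure.measurePreserving_swap (μ := pathLaw P B) (ν := pathLaw P B))
  rw [stationaryLaw_eq_map hB, Measure.map_map measurable_reverseConj
    measurable_driveReal_bilateral]
  conv_rhs => rw [← hmp.map_eq, Measure.map_map measurable_driveReal_bilateral hmp.measurable]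
  congr 1
  funext q
  exact reverseConj_driveReal_bilateral q.1 q.2

/-- The pair formed by the state at time `a` and the increments of the driving path after `a` is
distributed as the pair formed by the state at time `0` and the driving path. -/
lemma map_shift_stationaryLaw (hB : IsBrownianReal B P) (a : ℝ) :
    (stationaryLaw P B).map (shift a) = stationaryLaw P B := by
  have hν := isWiener_pathLaw hB
  have := hν.isProbabilityMeasure
  set β := ((pathLaw P B).prod (pathLaw P B)).map bilateral with hβ
  have : IsProbabilityMeasure β :=
    Measure.isProbabilityMeasure_map measurable_bilateral.aemeasurable
  have hm : Measurable fun q : C(ℝ, ℝ) × ℝ × ℝ => driveReal q.2 q.1 :=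
    measurable_driveReal.comp measurable_swap
  have hlaw : stationaryLaw P B =
      (β.prod (volume : Measure (ℝ × ℝ))).map fun q => driveReal q.2 q.1 := by
    have hmp : MeasurePreserving
        (fun q : (ℝ × ℝ) × C(ℝ≥0, ℝ) × C(ℝ≥0, ℝ) => (bilateral q.2, q.1))
        (volume.prod ((pathLaw P B).prod (pathLaw P B))) (β.prod volume) :=
      ((measurable_bilateral.measurePreserving ((pathLaw P B).prod (pathLaw P B))).prod
        (MeasurePreserving.id (volume : Measure (ℝ × ℝ)))).comp Measure.measurePreserving_swap
    rw [stationaryLaw_eq_map hB, ← hmp.map_eq, Measure.map_map hm hmp.measurable]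
    rfl
  have hskew := (hν.measurePreserving_increment a).skew_product
    (g := fun v p => driveReal p v a) (μc := (volume : Measure (ℝ × ℝ))) (μd := volume)
    ((measurable_path_eval a).comp hm)
    (Filter.Eventually.of_forall fun v => (measurePreserving_driveReal_eval v a).map_eq)
  rw [hlaw, Measure.map_map (measurable_shift a) hm]
  conv_rhs => rw [← hskew.map_eq, Measure.map_map hm hskew.measurable]
  congr 1
  funext q
  exact shift_driveReal q.2 q.1 a

/-! ### The Markov property -/

lemma ae_eval_zero_prod {ν : Measure C(ℝ≥0, ℝ)} (hν : IsWiener ν) :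
    ∀ᵐ q ∂((volume : Measure (ℝ × ℝ)).prod (ν.prod ν)), q.2.1 0 = 0 ∧ q.2.2 0 = 0 := by
  have := hν.isProbabilityMeasure
  exact Measure.quasiMeasurePreserving_snd.ae hν.ae_eval_zero

lemma driveReal_bilateral_zero (p : ℝ × ℝ) {w : C(ℝ≥0, ℝ) × C(ℝ≥0, ℝ)} (h₁ : w.1 0 = 0)
    (h₂ : w.2 0 = 0) : driveReal p (bilateral w) 0 = p := by
  simp [driveReal, bilateral, h₁, h₂]

lemma map_eval_zero_stationaryLaw (hB : IsBrownianReal B P) :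
    (stationaryLaw P B).map (fun z => z 0) = volume := by
  have hν := isWiener_pathLaw hB
  have := hν.isProbabilityMeasure
  rw [stationaryLaw_eq_map hB, Measure.map_map (measurable_path_eval 0)
    measurable_driveReal_bilateral]
  refine Eq.trans (Measure.map_congr ?_) (measurePreserving_fst
    (μ := (volume : Measure (ℝ × ℝ))) (ν := (pathLaw P B).prod (pathLaw P B))).map_eq
  filter_upwards [ae_eval_zero_prod hν] with q hq
  exact driveReal_bilateral_zero q.1 hq.1 hq.2

lemma past_le {E : Type*} [TopologicalSpace E] [MeasurableSpace E] (t : ℝ) :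
    (past t : MeasurableSpace C(ℝ, E)) ≤ pathMeasurableSpace :=
  iSup_le fun s => (measurable_path_eval (s : ℝ)).comap_le

/-- An event of the past up to time `t` only depends on the restriction of the path to times
`s ≤ t`. -/
lemma mem_iff_mem_of_past {E : Type*} [TopologicalSpace E] [MeasurableSpace E] {t : ℝ}
    {A : Set C(ℝ, E)} (hA : MeasurableSet[past t] A) {z z' : C(ℝ, E)}
    (h : ∀ s ≤ t, z s = z' s) : z ∈ A ↔ z' ∈ A := by
  have hle : (past t : MeasurableSpace C(ℝ, E)) ≤
      MeasurableSpace.comap (fun (z : C(ℝ, E)) (s : Set.Iic t) => z s) MeasurableSpace.pi := by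
    refine iSup_le fun s => ?_
    have : (fun z : C(ℝ, E) => z s) =
        (fun x : Set.Iic t → E => x s) ∘ fun (z : C(ℝ, E)) (s : Set.Iic t) => z s := rfl
    rw [this, ← MeasurableSpace.comap_comp]
    exact MeasurableSpace.comap_mono (measurable_pi_apply s).comap_le
  obtain ⟨A', -, rfl⟩ := hle A hA
  have : (fun s : Set.Iic t => z s) = fun s : Set.Iic t => z' s := funext fun s => h s s.2
  simp [Set.mem_preimage, this]

lemma measurableSet_past_preimage_shift {E : Type*} [TopologicalSpace E] [MeasurableSpace E]
    {t : ℝ} {A : Set C(ℝ, E)} (hA : MeasurableSet[past t] A) :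
    MeasurableSet[past 0] (shift (-t) ⁻¹' A) := by
  have hle : MeasurableSpace.comap (shift (-t)) (past t : MeasurableSpace C(ℝ, E)) ≤ past 0 := by
    rw [past, MeasurableSpace.comap_iSup]
    refine iSup_le fun s => ?_
    rw [MeasurableSpace.comap_comp]
    have hs : -t + (s : ℝ) ≤ 0 := by linarith [Set.mem_Iic.1 s.2]
    exact le_iSup (fun r : Set.Iic (0 : ℝ) =>
      MeasurableSpace.comap (fun z : C(ℝ, E) => z r) inferInstance) ⟨-t + s, hs⟩
  exact hle _ ⟨A, hA, rfl⟩

lemma measurable_lawPlus (hB : IsBrownianReal B P) : Measurable (lawPlus P B) := by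
  have := (isWiener_pathLaw hB).isProbabilityMeasure
  rw [funext (lawPlus_eq_map hB)]
  exact measurable_map_of_uncurry measurable_drive

/-- The Markov property at time `0`: given the state at time `0`, the past is a function of one of
the two driving Brownian motions and the future is a function of the other one. -/
lemma markov_zero (hB : IsBrownianReal B P) {A : Set C(ℝ, ℝ × ℝ)} (hA : MeasurableSet[past 0] A)
    {F : C(ℝ≥0, ℝ × ℝ) → ℝ≥0∞} (hF : Measurable F) :
    ∫⁻ z in A, F (future 0 z) ∂(stationaryLaw P B) =
      ∫⁻ z in A, (∫⁻ y, F y ∂(lawPlus P B (z 0))) ∂(stationaryLaw P B) := by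
  have hν := isWiener_pathLaw hB
  have := hν.isProbabilityMeasure
  set ν := pathLaw P B
  have hAm : MeasurableSet A := past_le 0 A hA
  let K : ℝ × ℝ → ℝ≥0∞ := fun p => ∫⁻ y, F y ∂(lawPlus P B p)
  have hK : Measurable K := (Measure.measurable_lintegral hF).comp (measurable_lawPlus hB)
  -- the indicator of `A`, as a function of the initial state and of the backward driving path
  let f : (ℝ × ℝ) × C(ℝ≥0, ℝ) → ℝ≥0∞ := fun r =>
    A.indicator 1 (driveReal r.1 (bilateral (0, r.2)))
  have hf : Measurable f :=
    (measurable_one.indicator hAm).comp (measurable_driveReal_bilateral.comp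
      (measurable_fst.prodMk (measurable_const.prodMk measurable_snd)))
  have hfA : ∀ q : (ℝ × ℝ) × C(ℝ≥0, ℝ) × C(ℝ≥0, ℝ), q.2.1 0 = 0 →
      A.indicator (1 : C(ℝ, ℝ × ℝ) → ℝ≥0∞) (driveReal q.1 (bilateral q.2)) = f (q.1, q.2.2) := by
    intro q hq
    have hmem := mem_iff_mem_of_past hA (z := driveReal q.1 (bilateral q.2))
      (z' := driveReal q.1 (bilateral (0, q.2.2))) fun s hs => by
        have h₁ := driveReal_bilateral_of_nonneg (conj q.1) (w := q.2.swap) hq (neg_nonneg.2 hs)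
        have h₂ := driveReal_bilateral_of_nonneg (conj q.1)
          (w := Prod.swap ((0 : C(ℝ≥0, ℝ)), q.2.2)) rfl (neg_nonneg.2 hs)
        rw [← reverseConj_driveReal_bilateral, reverseConj_apply, neg_neg] at h₁ h₂
        have h := h₁.trans h₂.symm
        simpa [conj, Prod.ext_iff] using h
    by_cases h : driveReal q.1 (bilateral q.2) ∈ A
    · simp [f, h, hmem.1 h]
    · simp [f, h, hmem.not.1 h]
  have hind : ∀ G : C(ℝ, ℝ × ℝ) → ℝ≥0∞, ∀ z, A.indicator G z = A.indicator 1 z * G z := by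
    intro G z
    by_cases h : z ∈ A <;> simp [h]
  have hfut : Measurable fun z : C(ℝ, ℝ × ℝ) => F (future 0 z) := hF.comp (measurable_future 0)
  have hKm : Measurable fun z : C(ℝ, ℝ × ℝ) => K (z 0) := hK.comp (measurable_path_eval 0)
  have hfp (p : ℝ × ℝ) : Measurable fun w => f (p, w) := hf.comp measurable_prodMk_left
  have hleft : ∫⁻ z in A, F (future 0 z) ∂(stationaryLaw P B) =
      ∫⁻ p, ∫⁻ w, F (drive p w.1) * f (p, w.2) ∂(ν.prod ν) := by
    rw [← lintegral_indicator hAm, stationaryLaw_eq_map hB,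
      lintegral_map (hfut.indicator hAm) measurable_driveReal_bilateral]
    rw [← lintegral_prod (fun q : (ℝ × ℝ) × C(ℝ≥0, ℝ) × C(ℝ≥0, ℝ) =>
      F (drive q.1 q.2.1) * f (q.1, q.2.2))]
    · refine lintegral_congr_ae ?_
      filter_upwards [ae_eval_zero_prod hν] with q hq
      rw [hind, hfA q hq.1, mul_comm]
      congr 2
      refine ContinuousMap.ext fun t => ?_
      have h := driveReal_bilateral_of_nonneg q.1 hq.2 t.coe_nonneg
      rw [show (t : ℝ).toNNReal = t from Real.toNNReal_coe] at h
      rw [← h]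
      change driveReal q.1 (bilateral q.2) (0 + (t : ℝ)) = _
      rw [zero_add]
    · exact ((hF.comp (measurable_drive.comp
        (measurable_fst.prodMk (measurable_fst.comp measurable_snd)))).mul
        (hf.comp (measurable_fst.prodMk (measurable_snd.comp measurable_snd)))).aemeasurable
  have hright : ∫⁻ z in A, K (z 0) ∂(stationaryLaw P B) =
      ∫⁻ p, ∫⁻ w, K p * f (p, w.2) ∂(ν.prod ν) := by
    rw [← lintegral_indicator hAm, stationaryLaw_eq_map hB,
      lintegral_map (hKm.indicator hAm) measurable_driveReal_bilateral]
    rw [← lintegral_prod (fun q : (ℝ × ℝ) × C(ℝ≥0, ℝ) × C(ℝ≥0, ℝ) =>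
      K q.1 * f (q.1, q.2.2))]
    · refine lintegral_congr_ae ?_
      filter_upwards [ae_eval_zero_prod hν] with q hq
      rw [hind, hfA q hq.1, mul_comm, driveReal_bilateral_zero q.1 hq.1 hq.2]
    · exact ((hK.comp measurable_fst).mul
        (hf.comp (measurable_fst.prodMk (measurable_snd.comp measurable_snd)))).aemeasurable
  rw [hleft]
  refine Eq.trans (lintegral_congr fun p => ?_) hright.symm
  rw [lintegral_prod_mul (f := fun w => F (drive p w)) (g := fun w => f (p, w))
      (hF.comp (measurable_drive_right p)).aemeasurable (hfp p).aemeasurable,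
    lintegral_prod_mul (f := fun _ => K p) (g := fun w => f (p, w))
      aemeasurable_const (hfp p).aemeasurable]
  simp only [K, lintegral_const, measure_univ, mul_one]
  rw [lawPlus_eq_map hB, lintegral_map hF (measurable_drive_right p)]

/-- The Markov property at any time follows from the one at time `0` by stationarity. -/
lemma isStationaryMarkov_stationaryLaw (hB : IsBrownianReal B P) :
    IsStationaryMarkov (stationaryLaw P B) (lawPlus P B) (volume : Measure (ℝ × ℝ)) where
  measurable_kernel := measurable_lawPlus hB
  isProbabilityMeasure_kernel p := by
    have := (isWiener_pathLaw hB).isProbabilityMeasure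
    rw [lawPlus_eq_map hB]
    exact Measure.isProbabilityMeasure_map
      (measurable_drive_right p).aemeasurable
  start_kernel p := by
    have hm : MeasurableSet {y : C(ℝ≥0, ℝ × ℝ) | y 0 = p} :=
      measurable_path_eval 0 (measurableSet_singleton p)
    rw [lawPlus_eq_map hB, ae_map_iff (measurable_drive_right p).aemeasurable hm]
    filter_upwards [(isWiener_pathLaw hB).eval_zero_ae_eq_zero] with w hw
    simp [drive, drivenPath, hw]
  stationary := map_shift_stationaryLaw hB
  marginal t := by
    rw [← map_eval_zero_stationaryLaw hB]
    conv_rhs => rw [← map_shift_stationaryLaw hB t,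
      Measure.map_map (measurable_path_eval 0) (measurable_shift t)]
    congr 1
    funext z
    simp [shift]
  markov t A hA F hF := by
    have hA₀ := measurableSet_past_preimage_shift hA
    have hAt : A = shift t ⁻¹' (shift (-t) ⁻¹' A) := by
      have h (z : C(ℝ, ℝ × ℝ)) : shift (-t) (shift t z) = z :=
        ContinuousMap.ext fun s => congrArg z (by ring)
      ext z
      rw [Set.mem_preimage, Set.mem_preimage, h]
    have hK : Measurable fun z : C(ℝ, ℝ × ℝ) => ∫⁻ y, F y ∂(lawPlus P B (z 0)) :=
      (Measure.measurable_lintegral hF).comp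
        ((measurable_lawPlus hB).comp (measurable_path_eval 0))
    have hFm : Measurable fun z : C(ℝ, ℝ × ℝ) => F (future 0 z) := hF.comp (measurable_future 0)
    have h := markov_zero hB hA₀ hF
    rw [← map_shift_stationaryLaw hB t,
      setLIntegral_map (past_le 0 _ hA₀) hFm (measurable_shift t),
      setLIntegral_map (past_le 0 _ hA₀) hK (measurable_shift t), ← hAt] at h
    have hfut (z : C(ℝ, ℝ × ℝ)) : future 0 (shift t z) = future t z :=
      ContinuousMap.ext fun s => congrArg z (by ring)
    have hev (z : C(ℝ, ℝ × ℝ)) : shift t z 0 = z t := congrArg z (add_zero t)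
    simpa only [hfut, hev] using h

end Stationary

end Kolmogorov

theorem lemma2 {Ω : Type*} [MeasurableSpace Ω] (P : Measure Ω) (B : ℝ≥0 → Ω → ℝ)
    (hB : IsBrownianReal B P) :
    (Kolmogorov.stationaryLaw P B).map Kolmogorov.reverseConj = Kolmogorov.stationaryLaw P B ∧
    (∀ t₀ : ℝ,
      (Kolmogorov.stationaryLaw P B).map (Kolmogorov.shift t₀) = Kolmogorov.stationaryLaw P B) ∧
    Kolmogorov.IsStationaryMarkov (Kolmogorov.stationaryLaw P B) (Kolmogorov.lawPlus P B)
      (volume : Measure (ℝ × ℝ)) :=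
  ⟨Kolmogorov.map_reverseConj_stationaryLaw hB, Kolmogorov.map_shift_stationaryLaw hB,
    Kolmogorov.isStationaryMarkov_stationaryLaw hB⟩
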